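/- Let $k$ be an algebraically closed field of characteristic zero, let $V$ be a vector space over $k$ of finite dimension $d$, and let $\mathcal M = V^*\otimes V^*\otimes V=\mathrm{Hom}_k(V\otimes V,V)$ be the space of all (not necessarily associative or unital) multiplication laws on $V$. For $m\in\mathcal M$, a left (respectively right) ideal of the algebra $(V,m)$ is a linear subspace $I\subseteq V$ such that $m(x,y)\in I$ for all $x\in V$, $y\in I$ (respectively for all $x\in I$, $y\in V$); $(V,m)$ is left-simple (respectively right-simple) if its only left (respectively right) ideals are $0$ and $V$. Then a generic algebra $(V,m)$ is both left-simple and right-simple: there is a Zariski-open dense subset $U\subseteq\mathcal M$ such that $(V,m)$ is left-simple and right-simple for every $m\in U$. Moreover, for every integer $r$ with $1\le r<d$, the set of all $m\in\mathcal M$ such that $(V,m)$ has an $r$-dimensional left ideal has dimension (Krull dimension in the Zariski topology) at most $d^3-r(d-1)(d-r)<d^3$, and the same bound holds for the set of all $m\in\mathcal M$ such that $(V,m)$ has an $r$-dimensional right ideal. -/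

import Mathlib

/-- The space of multiplication laws on `V`, i.e. bilinear maps `V × V → V`
(equivalently `V* ⊗ V* ⊗ V = Hom(V ⊗ V, V)`). -/
abbrev MulLaw (k V : Type*) [Field k] [AddCommGroup V] [Module k V] : Type _ :=
  V →ₗ[k] V →ₗ[k] V

/-- `I` is a left ideal of the algebra `(V, m)`: `m(x, y) ∈ I` for all `x ∈ V`, `y ∈ I`. -/
def IsLeftIdealOf {k V : Type*} [Field k] [AddCommGroup V] [Module k V]
    (m : MulLaw k V) (I : Submodule k V) : Prop :=
  ∀ x : V, ∀ y ∈ I, m x y ∈ I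

/-- `I` is a right ideal of the algebra `(V, m)`: `m(x, y) ∈ I` for all `x ∈ I`, `y ∈ V`. -/
def IsRightIdealOf {k V : Type*} [Field k] [AddCommGroup V] [Module k V]
    (m : MulLaw k V) (I : Submodule k V) : Prop :=
  ∀ x ∈ I, ∀ y : V, m x y ∈ I

/-- The algebra `(V, m)` has no left ideals besides `0` and `V`. -/
def IsLeftSimpleAlg {k V : Type*} [Field k] [AddCommGroup V] [Module k V]
    (m : MulLaw k V) : Prop :=
  ∀ I : Submodule k V, IsLeftIdealOf m I → I = ⊥ ∨ I = ⊤

/-- The algebra `(V, m)` has no right ideals besides `0` and `V`. -/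
def IsRightSimpleAlg {k V : Type*} [Field k] [AddCommGroup V] [Module k V]
    (m : MulLaw k V) : Prop :=
  ∀ I : Submodule k V, IsRightIdealOf m I → I = ⊥ ∨ I = ⊤

/-- The multiplication laws on `V` that have an `r`-dimensional left ideal. -/
def leftIdealLocus (k V : Type*) [Field k] [AddCommGroup V] [Module k V] (r : ℕ) :
    Set (MulLaw k V) :=
  {m | ∃ I : Submodule k V, Module.finrank k I = r ∧ IsLeftIdealOf m I}

/-- The multiplication laws on `V` that have an `r`-dimensional right ideal. -/
def rightIdealLocus (k V : Type*) [Field k] [AddCommGroup V] [Module k V] (r : ℕ) :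
    Set (MulLaw k V) :=
  {m | ∃ I : Submodule k V, Module.finrank k I = r ∧ IsRightIdealOf m I}

/-- The algebra of polynomial functions on a vector space `E`: the algebra of functions `E → k`
generated by the linear forms. -/
def polyFunctionsOn (k E : Type*) [Field k] [AddCommGroup E] [Module k E] :
    Subalgebra k (E → k) :=
  Algebra.adjoin k (Set.range fun φ : Module.Dual k E => (φ : E → k))

/-- The Zariski topology on a (finite-dimensional) vector space `E`: the sets
`{x | f x ≠ 0}`, for `f` a polynomial function, form a basis of open sets. -/
@[reducible] def zariskiTopologyOn (k E : Type*) [Field k] [AddCommGroup E] [Module k E] :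
    TopologicalSpace E :=
  TopologicalSpace.generateFrom {U | ∃ f ∈ polyFunctionsOn k E, U = {x | f x ≠ 0}}

/-- The dimension of a subset `S` of a (finite-dimensional) vector space `E`: the Krull dimension
of `S` with the topology induced by the Zariski topology of `E`. -/
noncomputable def zariskiDim (k : Type*) {E : Type*} [Field k] [AddCommGroup E] [Module k E]
    (S : Set E) : WithBot ℕ∞ :=
  @topologicalKrullDim S (@instTopologicalSpaceSubtype E (· ∈ S) (zariskiTopologyOn k E))

/-- `P` holds for a generic point of the (finite-dimensional) vector space `E`: it holds on a
Zariski-open Zariski-dense subset of `E`. -/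
def HoldsGenerically (k : Type*) {E : Type*} [Field k] [AddCommGroup E] [Module k E]
    (P : E → Prop) : Prop :=
  ∃ U : Set E, @IsOpen E (zariskiTopologyOn k E) U ∧ @Dense E (zariskiTopologyOn k E) U ∧
    ∀ x ∈ U, P x

/-! Both claims rest on one parameter count. If `J` is a left ideal of dimension `r`, it has a
complement `W` spanned by part of a fixed basis, and it is the graph of some `a : I → W`, where `I`
is spanned by the remaining basis vectors. A shear built from `a` carries `J` to `I`, so the law
comes from a pair (`a`, law preserving `I`). Such pairs form a space of dimension r(d-r) + (d³ -
dr(d-r)) = d³ - r(d-1)(d-r), and the law is polynomial in the pair. As there are finitely many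
coordinate pairs (`I`, `W`), the locus is covered by finitely many polynomial images of an affine
space (`leftIdealLocus_isCovered`); right ideals follow by passing to the opposite algebra.

A polynomial image of k^N has Krull dimension at most N: a chain of irreducible closed sets gives a
chain of prime ideals, hence as many functions algebraically independent on the image, and at most N
polynomials in N variables are independent. When N < dim E, the same bound makes the coordinates
dependent on the image, so it lies in a hypersurface. Multiplying the equations over all 0 < r < d
gives a nonzero polynomial whose nonvanishing forces simplicity on both sides. -/

open MvPolynomial in
/-- A strictly increasing chain of prime ideals of length `l` yields `l` elements which are
algebraically independent modulo the smallest ideal of the chain. -/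
theorem exists_algebraicIndependent_mod_of_strictMono {k R : Type*} [Field k] [CommRing R]
    [Algebra k R] (l : ℕ) (q : Fin (l + 1) → Ideal R) (hq : StrictMono q)
    (hp : ∀ i, (q i).IsPrime) :
    ∃ x : Fin l → R, ∀ f : MvPolynomial (Fin l) k, aeval x f ∈ q 0 → f = 0 := by
  induction l with
  | zero =>
    refine ⟨Fin.elim0, fun f hf => ?_⟩
    by_contra hne
    rw [eq_C_of_isEmpty f] at hf hne
    have hc : coeff 0 f ≠ 0 := by
      intro h
      exact hne (by rw [h, C_0])
    rw [← algebraMap_eq, AlgHom.commutes] at hf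
    exact (hp 0).ne_top (Ideal.eq_top_of_isUnit_mem _ hf ((IsUnit.mk0 _ hc).map (algebraMap k R)))
  | succ l ih =>
    obtain ⟨x, hx⟩ := ih (q ∘ Fin.succ) (hq.comp (Fin.strictMono_succ)) (fun i => hp _)
    have h01 : q 0 < q (Fin.succ 0) := hq (Fin.succ_pos 0)
    obtain ⟨y, hy1, hy0⟩ := SetLike.exists_of_lt h01
    have key : ∀ f : MvPolynomial (Fin (l + 1)) k,
        aeval (Fin.cons y x : Fin (l + 1) → R) f =
          (finSuccEquiv k l f).eval₂ (aeval x : MvPolynomial (Fin l) k →ₐ[k] R).toRingHom y := by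
      intro f
      induction f using MvPolynomial.induction_on with
      | C a => simp [finSuccEquiv_apply]
      | add p q hp hq => simp only [map_add, Polynomial.eval₂_add, hp, hq]
      | mul_X p i hp =>
        rw [map_mul, map_mul, Polynomial.eval₂_mul, hp]
        congr 1
        refine Fin.cases ?_ (fun j => ?_) i
        · simp [finSuccEquiv_X_zero]
        · simp [finSuccEquiv_X_succ]
    refine ⟨Fin.cons y x, fun f hf => ?_⟩
    by_contra hne
    rw [key] at hf
    have hg : finSuccEquiv k l f ≠ 0 := by simpa using hne
    -- View `f` as a polynomial in `y` and strip its powers of `y`, which is allowed because `y` is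
    -- outside the prime `q 0`. The remaining constant coefficient is nonzero, yet lies in `q 1`
    -- since `y` does, against the induction hypothesis.
    obtain ⟨g, hfg, hg0⟩ := Polynomial.exists_eq_pow_rootMultiplicity_mul_and_not_dvd _ hg 0
    rw [hfg, Polynomial.eval₂_mul, Polynomial.eval₂_pow] at hf
    have hgq := ((hp 0).mem_or_mem hf).resolve_left (fun h => hy0 (by
      simpa using (hp 0).mem_of_pow_mem _ h))
    have hcoeff : g.coeff 0 ≠ 0 := by
      rw [map_zero, sub_zero, Polynomial.X_dvd_iff] at hg0
      exact hg0
    apply hcoeff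
    apply hx
    have h1 : g.eval₂ (aeval x : MvPolynomial (Fin l) k →ₐ[k] R).toRingHom y ∈ q (Fin.succ 0) :=
      h01.le hgq
    rw [← Polynomial.divX_mul_X_add g, Polynomial.eval₂_add, Polynomial.eval₂_mul,
      Polynomial.eval₂_X, Polynomial.eval₂_C] at h1
    exact (Ideal.add_mem_iff_right _ (Ideal.mul_mem_left _ _ hy1)).1 h1

/-! ### Polynomial functions and polynomial maps -/

/-- A map between vector spaces is polynomial if its composition with every linear form is a
polynomial function. -/
def IsPolynomialMap (k : Type*) {F E : Type*} [Field k] [AddCommGroup F] [Module k F]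
    [AddCommGroup E] [Module k E] (φ : F → E) : Prop :=
  ∀ ℓ : Module.Dual k E, (fun x => ℓ (φ x)) ∈ polyFunctionsOn k F

/-- `S` is covered by the images of finitely many polynomial maps defined on `k ^ N`. -/
def IsCoveredByPolynomialImages (k : Type*) {E : Type*} [Field k] [AddCommGroup E] [Module k E]
    (N : ℕ) (S : Set E) : Prop :=
  ∃ (n : ℕ) (φ : Fin n → (Fin N → k) → E), (∀ i, IsPolynomialMap k (φ i)) ∧
    S ⊆ ⋃ i, Set.range (φ i)

section PolynomialFunctions

variable {k E F G : Type*} [Field k] [AddCommGroup E] [Module k E] [AddCommGroup F] [Module k F]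
  [AddCommGroup G] [Module k G]

theorem dual_mem_polyFunctionsOn (ℓ : Module.Dual k E) : (ℓ : E → k) ∈ polyFunctionsOn k E :=
  Algebra.subset_adjoin ⟨ℓ, rfl⟩

theorem eval_repr_mem_polyFunctionsOn {ι : Type*} (b : Module.Basis ι k E)
    (P : MvPolynomial ι k) : (fun x => MvPolynomial.eval (b.repr x) P) ∈ polyFunctionsOn k E := by
  induction P using MvPolynomial.induction_on with
  | C a =>
    simp only [MvPolynomial.eval_C]
    exact (polyFunctionsOn k E).algebraMap_mem a
  | add p q hp hq =>
    simp only [map_add]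
    exact add_mem hp hq
  | mul_X p i hp =>
    simp only [map_mul, MvPolynomial.eval_X]
    exact mul_mem hp (dual_mem_polyFunctionsOn (b.coord i))

theorem exists_eval_repr_of_mem_polyFunctionsOn {ι : Type*} [Fintype ι] (b : Module.Basis ι k E)
    {f : E → k} (hf : f ∈ polyFunctionsOn k E) :
    ∃ P : MvPolynomial ι k, ∀ x, f x = MvPolynomial.eval (b.repr x) P := by
  induction hf using Algebra.adjoin_induction with
  | mem f hf =>
    obtain ⟨ℓ, rfl⟩ := hf
    refine ⟨∑ i, MvPolynomial.C (ℓ (b i)) * MvPolynomial.X i, fun x => ?_⟩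
    conv_lhs => rw [← b.sum_repr x]
    simp only [map_sum, map_smul, map_mul, MvPolynomial.eval_C, MvPolynomial.eval_X, smul_eq_mul]
    exact Finset.sum_congr rfl fun i _ => mul_comm _ _
  | algebraMap a => exact ⟨MvPolynomial.C a, fun x => by simp⟩
  | add f g _ _ hf hg =>
    obtain ⟨P, hP⟩ := hf
    obtain ⟨Q, hQ⟩ := hg
    exact ⟨P + Q, fun x => by simp [hP, hQ]⟩
  | mul f g _ _ hf hg =>
    obtain ⟨P, hP⟩ := hf
    obtain ⟨Q, hQ⟩ := hg
    exact ⟨P * Q, fun x => by simp [hP, hQ]⟩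

theorem IsPolynomialMap.comp_mem {φ : F → E} (hφ : IsPolynomialMap k φ) {f : E → k}
    (hf : f ∈ polyFunctionsOn k E) : (fun x => f (φ x)) ∈ polyFunctionsOn k F := by
  induction hf using Algebra.adjoin_induction with
  | mem f hf =>
    obtain ⟨ℓ, rfl⟩ := hf
    exact hφ ℓ
  | algebraMap a => exact (polyFunctionsOn k F).algebraMap_mem a
  | add f g _ _ hf hg => exact add_mem hf hg
  | mul f g _ _ hf hg => exact mul_mem hf hg

theorem LinearMap.isPolynomialMap (L : F →ₗ[k] E) : IsPolynomialMap k L :=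
  fun ℓ => dual_mem_polyFunctionsOn (ℓ ∘ₗ L)

theorem IsPolynomialMap.comp {ψ : E → G} {φ : F → E} (hψ : IsPolynomialMap k ψ)
    (hφ : IsPolynomialMap k φ) : IsPolynomialMap k (fun x => ψ (φ x)) :=
  fun ℓ => hφ.comp_mem (hψ ℓ)

theorem IsPolynomialMap.add {φ ψ : F → E} (hφ : IsPolynomialMap k φ)
    (hψ : IsPolynomialMap k ψ) : IsPolynomialMap k (fun x => φ x + ψ x) := fun ℓ => by
  simp only [map_add]
  exact add_mem (hφ ℓ) (hψ ℓ)

theorem IsPolynomialMap.sub {φ ψ : F → E} (hφ : IsPolynomialMap k φ)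
    (hψ : IsPolynomialMap k ψ) : IsPolynomialMap k (fun x => φ x - ψ x) := fun ℓ => by
  simp only [map_sub]
  exact sub_mem (hφ ℓ) (hψ ℓ)

theorem IsPolynomialMap.bilinear {E' : Type*} [AddCommGroup E'] [Module k E']
    [FiniteDimensional k E] [FiniteDimensional k E'] (B : E →ₗ[k] E' →ₗ[k] G)
    {φ : F → E} {ψ : F → E'} (hφ : IsPolynomialMap k φ) (hψ : IsPolynomialMap k ψ) :
    IsPolynomialMap k (fun x => B (φ x) (ψ x)) := fun ℓ => by
  let b := Module.finBasis k E
  let b' := Module.finBasis k E'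
  have h : (fun x => ℓ (B (φ x) (ψ x))) =
      ∑ i, ∑ j, ℓ (B (b i) (b' j)) • ((fun x => b.coord i (φ x)) * fun x => b'.coord j (ψ x)) := by
    funext x
    have h1 := b.sum_repr (φ x)
    have h2 := b'.sum_repr (ψ x)
    conv_lhs => rw [← h1, ← h2]
    simp only [map_sum, LinearMap.sum_apply, map_smul, LinearMap.smul_apply, Finset.sum_apply,
      Pi.smul_apply, Pi.mul_apply, smul_eq_mul, Module.Basis.coord_apply]
    simp only [Finset.mul_sum]
    rw [Finset.sum_comm]
    refine Finset.sum_congr rfl fun i _ => Finset.sum_congr rfl fun j _ => by ring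
  rw [h]
  exact sum_mem fun i _ => sum_mem fun j _ =>
    Subalgebra.smul_mem _ (mul_mem (hφ _) (hψ _)) _

/-- Polynomial functions on `E` that stay algebraically independent after pulling back along a
polynomial map `k ^ N → E` are at most `N` in number. -/
theorem card_le_of_independent_comp {l N : ℕ} {φ : (Fin N → k) → E}
    (hφ : IsPolynomialMap k φ) (x : Fin l → E → k) (hx : ∀ i, x i ∈ polyFunctionsOn k E)
    (h : ∀ f : MvPolynomial (Fin l) k,
      (∀ y, MvPolynomial.eval (fun i => x i (φ y)) f = 0) → f = 0) : l ≤ N := by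
  choose P hP using fun i =>
    exists_eval_repr_of_mem_polyFunctionsOn (Pi.basisFun k (Fin N)) (hφ.comp_mem (hx i))
  have hind : AlgebraicIndependent k P := by
    rw [algebraicIndependent_iff]
    intro f hf
    refine h f fun y => ?_
    have := congrArg (MvPolynomial.eval ((Pi.basisFun k (Fin N)).repr y)) hf
    simp only [hP]
    rw [map_zero, MvPolynomial.map_aeval] at this
    rw [← this, MvPolynomial.eval]
    congr 2
    ext a
    simp
  have := hind.lift_cardinalMk_le_trdeg
  rw [MvPolynomial.trdeg_of_isDomain] at this
  simpa using this

end PolynomialFunctions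

/-! ### Zariski topology, dimension bound and genericity -/

section ZariskiTopology

variable {k E : Type*} [Field k] [AddCommGroup E] [Module k E]

theorem isTopologicalBasis_zariskiTopologyOn (k E : Type*) [Field k] [AddCommGroup E]
    [Module k E] :
    @TopologicalSpace.IsTopologicalBasis E (zariskiTopologyOn k E)
      {U | ∃ f ∈ polyFunctionsOn k E, U = {x | f x ≠ 0}} := by
  let _ := zariskiTopologyOn k E
  refine ⟨?_, ?_, rfl⟩
  · rintro _ ⟨f, hf, rfl⟩ _ ⟨g, hg, rfl⟩ x hx
    refine ⟨_, ⟨f * g, mul_mem hf hg, rfl⟩, mul_ne_zero hx.1 hx.2, fun y hy => ?_⟩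
    exact ⟨left_ne_zero_of_mul hy, right_ne_zero_of_mul hy⟩
  · exact Set.eq_univ_of_forall fun x =>
      Set.mem_sUnion.2 ⟨_, ⟨1, one_mem _, rfl⟩, one_ne_zero⟩

theorem isOpen_ne_zero_of_mem_polyFunctionsOn {f : E → k} (hf : f ∈ polyFunctionsOn k E) :
    @IsOpen E (zariskiTopologyOn k E) {x | f x ≠ 0} :=
  TopologicalSpace.isOpen_generateFrom_of_mem ⟨f, hf, rfl⟩

theorem isClosed_eq_zero_of_mem_polyFunctionsOn {f : E → k} (hf : f ∈ polyFunctionsOn k E) :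
    @IsClosed E (zariskiTopologyOn k E) {x | f x = 0} := by
  let _ := zariskiTopologyOn k E
  exact ⟨isOpen_ne_zero_of_mem_polyFunctionsOn hf⟩

theorem exists_mem_polyFunctionsOn_of_notMem {Z : Set E} (hZ : @IsClosed E (zariskiTopologyOn k E) Z)
    {x : E} (hx : x ∉ Z) : ∃ f ∈ polyFunctionsOn k E, (∀ z ∈ Z, f z = 0) ∧ f x ≠ 0 := by
  let _ := zariskiTopologyOn k E
  obtain ⟨_, ⟨f, hf, rfl⟩, hxf, hsub⟩ :=
    (isTopologicalBasis_zariskiTopologyOn k E).exists_subset_of_mem_open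
      (show x ∈ Zᶜ from hx) hZ.isOpen_compl
  exact ⟨f, hf, fun z hz => by_contra fun h => hsub h hz, hxf⟩

/-- The ideal of polynomial functions vanishing on a set. -/
def vanishingIdealOn (k : Type*) {E : Type*} [Field k] [AddCommGroup E] [Module k E]
    (Z : Set E) : Ideal (polyFunctionsOn k E) where
  carrier := {f | ∀ z ∈ Z, f.1 z = 0}
  add_mem' hf hg z hz := by simp [hf z hz, hg z hz]
  zero_mem' _ _ := rfl
  smul_mem' c f hf z hz := by simp [hf z hz]

theorem vanishingIdealOn_lt_of_ssubset {Z Z' : Set E} (hZ : @IsClosed E (zariskiTopologyOn k E) Z)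
    (h : Z ⊂ Z') : vanishingIdealOn k Z' < vanishingIdealOn k Z := by
  refine SetLike.lt_iff_le_and_exists.2 ⟨fun f hf z hz => hf z (h.1 hz), ?_⟩
  obtain ⟨x, hx, hxZ⟩ := Set.exists_of_ssubset h
  obtain ⟨f, hf, hfZ, hfx⟩ := exists_mem_polyFunctionsOn_of_notMem hZ hxZ
  exact ⟨⟨f, hf⟩, hfZ, fun h' => hfx (h' x hx)⟩

theorem isPrime_vanishingIdealOn {Z : Set E}
    (hZ : @IsIrreducible E (zariskiTopologyOn k E) Z) : (vanishingIdealOn k Z).IsPrime := by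
  let _ := zariskiTopologyOn k E
  refine ⟨?_, ?_⟩
  · obtain ⟨z, hz⟩ := hZ.1
    refine (Ideal.ne_top_iff_one _).2 fun h => one_ne_zero (α := k) (h z hz)
  · intro f g hfg
    have := isPreirreducible_iff_isClosed_union_isClosed.1 hZ.2 {x | f.1 x = 0} {x | g.1 x = 0}
      (isClosed_eq_zero_of_mem_polyFunctionsOn f.2) (isClosed_eq_zero_of_mem_polyFunctionsOn g.2)
      (fun z hz => mul_eq_zero.1 (hfg z hz))
    exact this.imp (fun h z hz => h hz) (fun h z hz => h hz)

/-- A set covered by finitely many polynomial images of `k ^ N` has dimension at most `N`. -/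
theorem IsCoveredByPolynomialImages.zariskiDim_le {N : ℕ} {S : Set E}
    (hS : IsCoveredByPolynomialImages k N S) : zariskiDim k S ≤ (N : WithBot ℕ∞) := by
  let _ := zariskiTopologyOn k E
  obtain ⟨n, φ, hφ, hcov⟩ := hS
  refine iSup_le fun p => ?_
  -- Taking closures in `E` keeps the chain strict, because `S` carries the induced topology.
  let Z : Fin (p.length + 1) → TopologicalSpace.IrreducibleCloseds E := fun i =>
    TopologicalSpace.IrreducibleCloseds.map Subtype.val continuous_subtype_val (p i)
  have hZmono : StrictMono Z :=
    (TopologicalSpace.IrreducibleCloseds.map_strictMono_of_isInducing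
      Topology.IsInducing.subtypeVal).comp p.strictMono
  have hZcov : ((Z (Fin.last _) : TopologicalSpace.IrreducibleCloseds E) : Set E) ⊆
      ⋃₀ (Finset.univ.image fun i => closure (Set.range (φ i)) : Finset (Set E)) := by
    have h1 : ((Z (Fin.last _) : TopologicalSpace.IrreducibleCloseds E) : Set E) =
        closure (Subtype.val '' (p (Fin.last _) : Set S)) := rfl
    rw [h1, Set.sUnion_eq_biUnion]
    refine closure_minimal ?_ (Set.Finite.isClosed_biUnion (Finset.finite_toSet _) ?_)
    · rintro _ ⟨x, -, rfl⟩
      obtain ⟨i, hi⟩ := Set.mem_iUnion.1 (hcov x.2)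
      exact Set.mem_biUnion (Finset.mem_coe.2 (Finset.mem_image_of_mem _ (Finset.mem_univ i)))
        (subset_closure hi)
    · intro t ht
      obtain ⟨i, -, rfl⟩ := Finset.mem_image.1 ht
      exact isClosed_closure
  obtain ⟨t, ht, hZt⟩ := isIrreducible_iff_sUnion_isClosed.1 (Z (Fin.last _)).isIrreducible _
    (by
      intro t ht
      obtain ⟨i, -, rfl⟩ := Finset.mem_image.1 ht
      exact isClosed_closure) hZcov
  obtain ⟨i, -, rfl⟩ := Finset.mem_image.1 ht
  -- Vanishing ideals reverse inclusion, hence `rev`: the smallest prime belongs to the largest set,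
  -- the one contained in the closure of a single image.
  obtain ⟨x, hx⟩ := exists_algebraicIndependent_mod_of_strictMono (k := k) p.length
    (fun j => vanishingIdealOn k (Z j.rev : Set E))
    (fun a b hab => vanishingIdealOn_lt_of_ssubset (Z b.rev).isClosed
      (hZmono (Fin.rev_lt_rev.2 hab)))
    (fun j => isPrime_vanishingIdealOn (Z j.rev).isIrreducible)
  have hle : p.length ≤ N := by
    refine card_le_of_independent_comp (hφ i) (fun j => (x j).1) (fun j => (x j).2) ?_
    intro f hf
    refine hx f ?_
    have hval : ∀ y, (MvPolynomial.aeval x f).1 y = MvPolynomial.eval (fun j => (x j).1 y) f := by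
      intro y
      have := MvPolynomial.map_aeval x
        (((Pi.evalRingHom (fun _ : E => k) y).comp (polyFunctionsOn k E).val.toRingHom)) f
      refine this.trans ?_
      rw [MvPolynomial.eval]
      congr 2
    have hcl : closure (Set.range (φ i)) ⊆ {y | (MvPolynomial.aeval x f).1 y = 0} := by
      refine closure_minimal ?_ (isClosed_eq_zero_of_mem_polyFunctionsOn (MvPolynomial.aeval x f).2)
      rintro _ ⟨y, rfl⟩
      exact (hval _).trans (hf y)
    intro z hz
    rw [Fin.rev_zero] at hz
    exact hcl (hZt hz)
  exact_mod_cast hle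

/-- Over an infinite field a polynomial is determined by its values, so this reduces to polynomial
rings being domains. -/
theorem noZeroDivisors_polyFunctionsOn (k E : Type*) [Field k] [AddCommGroup E] [Module k E]
    [Infinite k] [FiniteDimensional k E] : NoZeroDivisors (polyFunctionsOn k E) := by
  refine ⟨fun {f g} hfg => ?_⟩
  let b := Module.finBasis k E
  obtain ⟨P, hP⟩ := exists_eval_repr_of_mem_polyFunctionsOn b f.2
  obtain ⟨Q, hQ⟩ := exists_eval_repr_of_mem_polyFunctionsOn b g.2
  have hPQ : P * Q = 0 := by
    refine MvPolynomial.funext fun y => ?_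
    have h := congrFun (congrArg Subtype.val hfg) (b.equivFun.symm y)
    have hy : ⇑(b.repr (b.equivFun.symm y)) = y := b.equivFun.apply_symm_apply y
    have h' : f.1 (b.equivFun.symm y) * g.1 (b.equivFun.symm y) = 0 := h
    rw [hP, hQ, hy] at h'
    simpa using h'
  rcases mul_eq_zero.1 hPQ with h | h
  · exact Or.inl (Subtype.ext (funext fun x => by rw [hP, h]; exact map_zero _))
  · exact Or.inr (Subtype.ext (funext fun x => by rw [hQ, h]; exact map_zero _))

/-- A polynomial image of `k ^ N` with `N < dim E` lies in a hypersurface. -/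
theorem IsPolynomialMap.exists_ne_zero [Infinite k] [FiniteDimensional k E] {N : ℕ}
    {φ : (Fin N → k) → E} (hφ : IsPolynomialMap k φ) (hN : N < Module.finrank k E) :
    ∃ f : polyFunctionsOn k E, f ≠ 0 ∧ ∀ y, f.1 (φ y) = 0 := by
  let b := Module.finBasis k E
  by_contra! hcon
  refine hN.not_ge (card_le_of_independent_comp hφ (fun i => b.coord i)
    (fun i => dual_mem_polyFunctionsOn _) fun P hP => ?_)
  by_contra hP0
  obtain ⟨y, hy⟩ := hcon ⟨_, eval_repr_mem_polyFunctionsOn b P⟩ (fun h0 => hP0 (by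
    refine MvPolynomial.funext fun y => ?_
    have h := congrFun (congrArg Subtype.val h0) (b.equivFun.symm y)
    have hy : ⇑(b.repr (b.equivFun.symm y)) = y := b.equivFun.apply_symm_apply y
    have h' : MvPolynomial.eval (b.repr (b.equivFun.symm y)) P = 0 := h
    rwa [hy] at h'))
  exact hy (hP y)

/-- A set covered by finitely many polynomial images of `k ^ N` with `N < dim E` lies in a
hypersurface. -/
theorem IsCoveredByPolynomialImages.exists_ne_zero [Infinite k] [FiniteDimensional k E] {N : ℕ}
    {S : Set E} (hS : IsCoveredByPolynomialImages k N S) (hN : N < Module.finrank k E) :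
    ∃ f : polyFunctionsOn k E, f ≠ 0 ∧ ∀ x ∈ S, f.1 x = 0 := by
  have := noZeroDivisors_polyFunctionsOn k E
  obtain ⟨n, φ, hφ, hcov⟩ := hS
  choose f hf0 hf using fun i => (hφ i).exists_ne_zero hN
  refine ⟨∏ i, f i, Finset.prod_ne_zero_iff.2 fun i _ => hf0 i, fun x hx => ?_⟩
  obtain ⟨i, y, rfl⟩ := Set.mem_iUnion.1 (hcov hx)
  rw [← Finset.mul_prod_erase _ _ (Finset.mem_univ i)]
  exact mul_eq_zero_of_left (hf i y) _

/-- A property holds generically if it holds where a nonzero polynomial function does not vanish. -/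
theorem holdsGenerically_of_ne_zero [Infinite k] [FiniteDimensional k E] {P : E → Prop}
    (f : polyFunctionsOn k E) (hf0 : f ≠ 0) (h : ∀ x, f.1 x ≠ 0 → P x) :
    HoldsGenerically k P := by
  have := noZeroDivisors_polyFunctionsOn k E
  let _ := zariskiTopologyOn k E
  refine ⟨{x | f.1 x ≠ 0}, isOpen_ne_zero_of_mem_polyFunctionsOn f.2, ?_, h⟩
  rw [(isTopologicalBasis_zariskiTopologyOn k E).dense_iff]
  rintro _ ⟨g, hg, rfl⟩ ⟨x, hx⟩
  have hfg : (⟨g, hg⟩ * f : polyFunctionsOn k E) ≠ 0 :=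
    mul_ne_zero (fun h0 => hx (congrFun (congrArg Subtype.val h0) x)) hf0
  by_contra hne
  rw [Set.not_nonempty_iff_eq_empty] at hne
  refine hfg (Subtype.ext (funext fun y => by_contra fun hy => ?_))
  have hy' : g y * f.1 y ≠ 0 := hy
  have : y ∈ ({x | g x ≠ 0} ∩ {x | f.1 x ≠ 0} : Set E) :=
    ⟨left_ne_zero_of_mul hy', right_ne_zero_of_mul hy'⟩
  rw [hne] at this
  exact this

end ZariskiTopology

/-! ### Parametrizing laws with an ideal of given dimension -/

section IdealLoci

variable {k V : Type*} [Field k] [AddCommGroup V] [Module k V]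

/-- Every subspace has a complement spanned by a part of a given basis. -/
theorem exists_isCompl_span_image {ι : Type*} (b : Module.Basis ι k V) (I : Submodule k V) :
    ∃ s : Set ι, IsCompl I (Submodule.span k (b '' s)) := by
  -- Choose a maximal set of basis vectors independent modulo `I`.
  obtain ⟨s, -, -, hspan, hli⟩ := exists_linearIndepOn_extension (K := k) (v := I.mkQ ∘ b)
    (linearIndepOn_empty k _) (Set.empty_subset Set.univ)
  refine ⟨s, IsCompl.symm ⟨?_, ?_⟩⟩
  · have := Submodule.range_ker_disjoint (f := I.mkQ) (v := fun i : s => b i) hli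
    rwa [Submodule.ker_mkQ, ← Set.image_eq_range] at this
  · rw [codisjoint_iff, sup_comm, ← Submodule.comap_map_mkQ, Submodule.map_span, ← Set.image_comp]
    have h : Submodule.span k ((I.mkQ ∘ b) '' s) = ⊤ := by
      rw [eq_top_iff, ← (LinearMap.range_eq_top.2 I.mkQ_surjective), LinearMap.range_eq_map,
        ← b.span_eq, Submodule.map_span, ← Set.range_comp, ← Set.image_univ]
      exact Submodule.span_le.2 hspan
    rw [h, Submodule.comap_top]

/-- The multiplication laws for which `I` is a left ideal. -/
def leftIdealLaws (I : Submodule k V) : Submodule k (MulLaw k V) where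
  carrier := {m | IsLeftIdealOf m I}
  add_mem' hm hn x y hy := I.add_mem (hm x y hy) (hn x y hy)
  zero_mem' _ _ _ := I.zero_mem
  smul_mem' c _ hm x y hy := I.smul_mem c (hm x y hy)

/-- Rank-nullity for the surjection sending `m` to the `W`-component of its restriction to `V × I`;
the kernel consists of the laws preserving `I`. -/
theorem finrank_leftIdealLaws_add [FiniteDimensional k V] {I W : Submodule k V}
    (h : IsCompl I W) :
    Module.finrank k (leftIdealLaws I) +
      Module.finrank k V * (Module.finrank k I * Module.finrank k W) = Module.finrank k V ^ 3 := by
  let T : MulLaw k V →ₗ[k] V →ₗ[k] I →ₗ[k] W :=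
    { toFun := fun m => (m.compl₂ I.subtype).compr₂ (W.projectionOnto I h.symm)
      map_add' := fun _ _ => by ext; simp
      map_smul' := fun _ _ => by ext; simp }
  have hT : ∀ m x y, T m x y = W.projectionOnto I h.symm (m x y) := fun _ _ _ => rfl
  have hker : LinearMap.ker T = leftIdealLaws I := by
    ext m
    constructor
    · intro hm x y hy
      have := LinearMap.congr_fun (LinearMap.congr_fun hm x) ⟨y, hy⟩
      rw [hT] at this
      simpa using this
    · intro hm
      refine LinearMap.ext fun x => LinearMap.ext fun y => ?_
      rw [hT]
      simpa using hm x y y.2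
  have hsurj : LinearMap.range T = ⊤ := by
    refine LinearMap.range_eq_top.2 fun n => ?_
    refine ⟨(n.compl₂ (I.projectionOnto W h)).compr₂ W.subtype, ?_⟩
    refine LinearMap.ext fun x => LinearMap.ext fun y => ?_
    rw [hT]
    simp
  have := LinearMap.finrank_range_add_finrank_ker (V := MulLaw k V)
    (V₂ := V →ₗ[k] I →ₗ[k] W) T
  rw [hker, hsurj, finrank_top, Module.finrank_linearMap, Module.finrank_linearMap,
    Module.finrank_linearMap, Module.finrank_linearMap] at this
  rw [add_comm, this]
  ring

/-- The law obtained by transporting `m` along the shear `1 + a` of `V = I ⊕ W`,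
where `a : I → W`. -/
noncomputable def shearLaw {I W : Submodule k V} (h : IsCompl I W) (p : (I →ₗ[k] W) × leftIdealLaws I) :
    MulLaw k V :=
  -- Since g² = 0, the inverse of 1 + g is 1 - g, so the law (x, y) ↦ (1 + g) m(x, (1 - g) y) is
  -- polynomial in the pair. The first argument is left alone: a left ideal is just a subspace
  -- stable under every `m x`.
  let g : V →ₗ[k] V := W.subtype ∘ₗ p.1 ∘ₗ I.projectionOnto W h
  (p.2.1 + p.2.1.compr₂ g) - (p.2.1 + p.2.1.compr₂ g).compl₂ g

theorem isPolynomialMap_shearLaw [FiniteDimensional k V] {I W : Submodule k V}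
    (h : IsCompl I W) : IsPolynomialMap k (shearLaw h) := by
  let B₁ : MulLaw k V →ₗ[k] (V →ₗ[k] V) →ₗ[k] MulLaw k V :=
    LinearMap.mk₂ k (fun m g => m.compr₂ g) (fun _ _ _ => by ext; simp)
      (fun _ _ _ => by ext; simp) (fun _ _ _ => by ext; simp) (fun _ _ _ => by ext; simp)
  let B₂ : MulLaw k V →ₗ[k] (V →ₗ[k] V) →ₗ[k] MulLaw k V :=
    LinearMap.mk₂ k (fun m g => m.compl₂ g) (fun _ _ _ => by ext; simp)
      (fun _ _ _ => by ext; simp) (fun _ _ _ => by ext; simp) (fun _ _ _ => by ext; simp)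
  let L₁ : ((I →ₗ[k] W) × leftIdealLaws I) →ₗ[k] (V →ₗ[k] V) :=
    { toFun := fun p => W.subtype ∘ₗ p.1 ∘ₗ I.projectionOnto W h
      map_add' := fun _ _ => by ext; simp
      map_smul' := fun _ _ => by ext; simp }
  let L₂ : ((I →ₗ[k] W) × leftIdealLaws I) →ₗ[k] MulLaw k V :=
    (leftIdealLaws I).subtype ∘ₗ LinearMap.snd k _ _
  have h₁ := LinearMap.isPolynomialMap (F := (I →ₗ[k] W) × leftIdealLaws I)
    (E := V →ₗ[k] V) L₁
  have h₂ := LinearMap.isPolynomialMap (F := (I →ₗ[k] W) × leftIdealLaws I)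
    (E := MulLaw k V) L₂
  have h₃ := h₂.add (IsPolynomialMap.bilinear B₁ h₂ h₁)
  exact h₃.sub (IsPolynomialMap.bilinear B₂ h₃ h₁)

/-- If `J` and `I` have the common complement `W`, every law with left ideal `J` is a shear of a
law with left ideal `I`. -/
theorem IsLeftIdealOf.mem_range_shearLaw {I J W : Submodule k V} (h : IsCompl I W)
    (hJ : IsCompl J W) {m : MulLaw k V} (hm : IsLeftIdealOf m J) :
    m ∈ Set.range (shearLaw h) := by
  -- `J` is the graph of `a`
  let a : I →ₗ[k] W := -(W.projectionOnto J hJ.symm ∘ₗ I.subtype)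
  let g : V →ₗ[k] V := W.subtype ∘ₗ a ∘ₗ I.projectionOnto W h
  have hgW : ∀ w : W, g w = 0 := fun w => by simp [g]
  have hgg : ∀ v, g (g v) = 0 := fun v =>
    hgW (a (I.projectionOnto W h v))
  have hgI : ∀ y ∈ I, y + g y ∈ J := fun y hy => by
    have h1 := Submodule.projection_add_projection_eq_self hJ y
    have h2 : y + g y = J.projection W hJ y := by
      simp [g, a, Submodule.projectionOnto_apply_of_mem_left h hy]
      nth_rewrite 1 [← h1]
      abel
    rw [h2]
    exact Submodule.projection_apply_mem _ _
  have hgJ : ∀ y ∈ J, y - g y ∈ I := fun y hy => by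
    have h1 := Submodule.projection_add_projection_eq_self h y
    have h2 : y - g y = I.projection W h y := by
      have h3 : W.projectionOnto J hJ.symm y = 0 := by simpa using hy
      have h4 : I.projection W h y = y - W.projectionOnto I h.symm y := by
        rw [Submodule.coe_projectionOnto_apply]
        exact eq_sub_of_add_eq h1
      simp [g, a, h4, h3]
    rw [h2]
    exact Submodule.projection_apply_mem _ _
  -- The inverse shear (1 - g) m(x, (1 + g) y): here 1 + g maps `I` into `J` and 1 - g maps `J` into
  -- `I`.
  let m₀ : MulLaw k V := (m - m.compr₂ g) + (m - m.compr₂ g).compl₂ g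
  have hm₀ : ∀ x y, m₀ x y = m x (y + g y) - g (m x (y + g y)) := fun x y => by
    simp only [m₀, LinearMap.add_apply, LinearMap.sub_apply, LinearMap.compl₂_apply,
      LinearMap.compr₂_apply, map_add]
    abel
  have hm₀I : IsLeftIdealOf m₀ I := fun x y hy => by
    rw [hm₀]
    exact hgJ _ (hm x _ (hgI y hy))
  refine ⟨(a, ⟨m₀, hm₀I⟩), LinearMap.ext fun x => LinearMap.ext fun y => ?_⟩
  have h1 : shearLaw h (a, ⟨m₀, hm₀I⟩) x y =
      m₀ x y + g (m₀ x y) - (m₀ x (g y) + g (m₀ x (g y))) := rfl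
  rw [h1, hm₀, hm₀]
  simp only [map_add, map_sub, hgg, map_zero]
  abel

theorem leftIdealLocus_isCovered [FiniteDimensional k V] {d r : ℕ}
    (hd : Module.finrank k V = d) (hr : r < d) :
    IsCoveredByPolynomialImages k (d ^ 3 - r * (d - 1) * (d - r)) (leftIdealLocus k V r) := by
  subst hd
  set d := Module.finrank k V with hd
  let b := Module.finBasis k V
  let I : Set (Fin d) → Submodule k V := fun s => Submodule.span k (b '' sᶜ)
  let W : Set (Fin d) → Submodule k V := fun s => Submodule.span k (b '' s)
  have hcompl : ∀ s, IsCompl (I s) (W s) := fun s =>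
    b.linearIndependent.isCompl_span_image b.span_eq isCompl_compl.symm
  let A := {s : Set (Fin d) // Module.finrank k (W s) = d - r}
  have hex : ∀ s : A, Nonempty ((Fin (d ^ 3 - r * (d - 1) * (d - r)) → k) ≃ₗ[k]
      ((I s →ₗ[k] W s) × leftIdealLaws (I s))) := fun s => by
    have hI := Submodule.finrank_add_eq_of_isCompl (hcompl s)
    have hL := finrank_leftIdealLaws_add (hcompl s)
    rw [s.2, ← hd] at hI
    have hI' : Module.finrank k (I s) = r := by omega
    rw [hI', s.2, ← hd] at hL
    have : Module.Free k (leftIdealLaws (I s)) :=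
      Module.Free.of_divisionRing k (leftIdealLaws (I s))
    refine ⟨LinearEquiv.ofFinrankEq _ _ ?_⟩
    rw [Module.finrank_fin_fun, Module.finrank_prod, Module.finrank_linearMap, hI', s.2]
    obtain ⟨e, he⟩ : ∃ e, d = e + 1 := ⟨d - 1, by omega⟩
    -- One of the d copies of r(d-r) in the codimension is paid back by the choice of `a`, which
    -- turns d into d - 1.
    have hmul : d * (r * (d - r)) = r * (d - 1) * (d - r) + r * (d - r) := by
      generalize d - r = t
      rw [he, Nat.add_sub_cancel]
      ring
    rw [hmul] at hL
    omega
  let φ : A → (Fin (d ^ 3 - r * (d - 1) * (d - r)) → k) → MulLaw k V := fun s y =>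
    shearLaw (hcompl s) ((hex s).some y)
  have hφ : ∀ s, IsPolynomialMap k (φ s) := fun s =>
    (isPolynomialMap_shearLaw (hcompl s)).comp (LinearMap.isPolynomialMap
      (E := (I s →ₗ[k] W s) × leftIdealLaws (I s)) (hex s).some.toLinearMap)
  have : Fintype A := Fintype.ofFinite A
  let e := Fintype.equivFin A
  refine ⟨Fintype.card A, fun i => φ (e.symm i), fun i => hφ _, ?_⟩
  rintro m ⟨J, hJr, hJ⟩
  obtain ⟨s, hs⟩ := exists_isCompl_span_image b J
  have hW := Submodule.finrank_add_eq_of_isCompl hs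
  have hs' : Module.finrank k (W s) = d - r := by
    change Module.finrank k (Submodule.span k (b '' s)) = d - r
    omega
  obtain ⟨p, hp⟩ := hJ.mem_range_shearLaw (hcompl s) hs
  refine Set.mem_iUnion.2 ⟨e ⟨s, hs'⟩, (hex ⟨s, hs'⟩).some.symm p, ?_⟩
  simp only [Equiv.symm_apply_apply, φ, LinearEquiv.apply_symm_apply]
  exact hp

theorem rightIdealLocus_isCovered [FiniteDimensional k V] {d r : ℕ}
    (hd : Module.finrank k V = d) (hr : r < d) :
    IsCoveredByPolynomialImages k (d ^ 3 - r * (d - 1) * (d - r)) (rightIdealLocus k V r) := by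
  obtain ⟨n, φ, hφ, hcov⟩ := leftIdealLocus_isCovered (k := k) hd hr
  -- Swapping the arguments is linear and exchanges left and right ideals.
  let L : MulLaw k V →ₗ[k] MulLaw k V := LinearMap.lflip.toLinearMap
  refine ⟨n, fun i y => L (φ i y), fun i =>
    (LinearMap.isPolynomialMap (E := MulLaw k V) (F := MulLaw k V) L).comp (hφ i), ?_⟩
  rintro m ⟨I, hI, hm⟩
  obtain ⟨i, y, hy⟩ := Set.mem_iUnion.1 (hcov (show L m ∈ leftIdealLocus k V r from
    ⟨I, hI, fun x y hy => hm y hy x⟩))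
  exact Set.mem_iUnion.2 ⟨i, y, by simp only [hy]; rfl⟩

end IdealLoci

/-! ### Main theorem -/

theorem mainTheorem6 {k V : Type*} [Field k] [IsAlgClosed k] [CharZero k]
    [AddCommGroup V] [Module k V] [FiniteDimensional k V]
    (d : ℕ) (hd : Module.finrank k V = d) :
    HoldsGenerically k (fun m : MulLaw k V => IsLeftSimpleAlg m ∧ IsRightSimpleAlg m) ∧
    ∀ r : ℕ, 1 ≤ r → r < d →
      zariskiDim k (leftIdealLocus k V r) ≤ ((d ^ 3 - r * (d - 1) * (d - r) : ℕ) : WithBot ℕ∞) ∧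
      zariskiDim k (rightIdealLocus k V r) ≤ ((d ^ 3 - r * (d - 1) * (d - r) : ℕ) : WithBot ℕ∞) ∧
      (d : ℤ) ^ 3 - r * (d - 1) * (d - r) < (d : ℤ) ^ 3 := by
  refine ⟨?_, fun r hr1 hrd => ⟨(leftIdealLocus_isCovered hd hrd).zariskiDim_le,
    (rightIdealLocus_isCovered hd hrd).zariskiDim_le, ?_⟩⟩
  · have hdim : Module.finrank k (MulLaw k V) = d ^ 3 := by
      rw [Module.finrank_linearMap, Module.finrank_linearMap, hd]
      ring
    have hlt : ∀ r, 1 ≤ r → r < d → d ^ 3 - r * (d - 1) * (d - r) < Module.finrank k (MulLaw k V) :=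
      fun r hr1 hrd => by
        rw [hdim]
        refine Nat.sub_lt (pow_pos (by omega) 3) ?_
        exact Nat.mul_pos (Nat.mul_pos (by omega) (by omega)) (by omega)
    have hex : ∀ r : Finset.Ico 1 d, ∃ f : polyFunctionsOn k (MulLaw k V), f ≠ 0 ∧
        ∀ m ∈ leftIdealLocus k V r ∪ rightIdealLocus k V r, f.1 m = 0 := fun r => by
      have := noZeroDivisors_polyFunctionsOn k (MulLaw k V)
      obtain ⟨hr1, hrd⟩ := Finset.mem_Ico.1 r.2
      obtain ⟨f, hf0, hf⟩ := (leftIdealLocus_isCovered hd hrd).exists_ne_zero (hlt r hr1 hrd)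
      obtain ⟨g, hg0, hg⟩ := (rightIdealLocus_isCovered hd hrd).exists_ne_zero (hlt r hr1 hrd)
      exact ⟨f * g, mul_ne_zero hf0 hg0, fun m hm => hm.elim
        (fun h => mul_eq_zero_of_left (hf m h) _) (fun h => mul_eq_zero_of_right _ (hg m h))⟩
    choose f hf0 hf using hex
    have := noZeroDivisors_polyFunctionsOn k (MulLaw k V)
    refine holdsGenerically_of_ne_zero (∏ r, f r) (Finset.prod_ne_zero_iff.2 fun r _ => hf0 r) ?_
    intro m hm
    have hm' : ∀ r, 1 ≤ r → r < d → m ∉ leftIdealLocus k V r ∪ rightIdealLocus k V r := by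
      intro r hr1 hrd hmr
      refine hm ?_
      rw [← Finset.mul_prod_erase _ _ (Finset.mem_univ ⟨r, Finset.mem_Ico.2 ⟨hr1, hrd⟩⟩)]
      exact mul_eq_zero_of_left (hf _ m hmr) _
    have hI : ∀ I : Submodule k V,
        m ∉ leftIdealLocus k V (Module.finrank k I) ∪ rightIdealLocus k V (Module.finrank k I) ∨
          I = ⊥ ∨ I = ⊤ := fun I => by
      -- A nonzero proper subspace has dimension in [1, d), where `hm'` excludes both loci.
      by_cases h0 : I = ⊥
      · exact Or.inr (Or.inl h0)
      by_cases h1 : I = ⊤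
      · exact Or.inr (Or.inr h1)
      exact Or.inl (hm' _ (Submodule.one_le_finrank_iff.2 h0)
        (hd ▸ Submodule.finrank_lt h1))
    exact ⟨fun I h => (hI I).resolve_left fun hn => hn (Or.inl ⟨I, rfl, h⟩),
      fun I h => (hI I).resolve_left fun hn => hn (Or.inr ⟨I, rfl, h⟩)⟩
  · have h1 : (0 : ℤ) < r * (d - 1) * (d - r) :=
      mul_pos (mul_pos (by omega) (by omega)) (by omega)
    linarith
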